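/- **Setting.** Let $N\ge1$, let $\mathcal A=\{0,1,\dots,N-1\}$, and let $\alpha_0,\dots,\alpha_{N-1}$ be non-negative integers with $\alpha_0\ge1$ and $\alpha_\ell\le\alpha_0$ for all $\ell$. Let $\varphi$ be a *Parry substitution* on $\mathcal A$ with these exponents, i.e. one of the following. * (simple) $\varphi(i)=0^{\alpha_i}(i+1)$ for $i<N-1$ and $\varphi(N-1)=0^{\alpha_{N-1}}$, where $\alpha_{N-1}\ge1$, where $N\ge2$ or $\alpha_0\ge2$, and where $t=\alpha_0\alpha_1\cdots\alpha_{N-1}000\cdots$ is lexicographically strictly larger than each of its proper shifts; * (non-simple) for some $1\le m\le N-1$, $\varphi(i)=0^{\alpha_i}(i+1)$ for $i<N-1$ and $\varphi(N-1)=0^{\alpha_{N-1}}m$, where $\alpha_\ell\ge1$ for some $\ell\ge m$, and where $t=\alpha_0\cdots\alpha_{m-1}(\alpha_m\cdots\alpha_{N-1})^\omega$ is lexicographically strictly larger than each of its proper shifts. Let the infinite word $\mathbf u=u_0u_1u_2\cdots$ be a fixed point of $\varphi$ (a *Parry word*), and suppose that $\mathbf u$ is $c$-balanced for some $c$, i.e.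 $\bigl||v|_a-|w|_a\bigr|\le c$ for every letter $a$ and all factors $v,w$ of $\mathbf u$ of the same length, where $|w|_a$ is the number of occurrences of $a$ in $w$. For a finite word $w$ let $\Psi(w)=(|w|_0,\dots,|w|_{N-1})$. For a factor $w$ of $\mathbf u$ of length $n$ let $\Psi^{\rm rel}(w)=\Psi(w)-\Psi(u_0\cdots u_{n-1})$, and let $\mathcal P^{\rm rel}(n)$ be the set of the vectors $\Psi^{\rm rel}(w)$ for all factors $w$ of length $n$. Let $\mathrm{AC}(n)$ be the number of distinct vectors $\Psi(w)$ for factors $w$ of length $n$, and let $$B_{\mathbf u}(n)=\max\bigl\{\bigl||w|_a-|w'|_a\bigr| : a\in\mathcal A,\ w,w'\text{ factors of }\mathbf u,\ |w|=|w'|=n\bigr\}$$ be the balance function. Let $U_j=|\varphi^j(0)|$, and for $n\ge1$ let $\langle n\rangle_U=d_k\cdots d_0$ be the normal $U$-representation of $n$, i.e. the word of the digits given by the greedy algorithm, where $U_k\le n<U_{k+1}$. A sequence $(x_n)_{n\ge1}$ is *$U$-automatic* if there are a deterministic finite automaton with input alphabet $\{0,\dots,\alpha_0\}$, initial state $q_0$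 and transition function $\delta$, and an output function $\tau$ with values in a finite set, such that for all $n\ge1$ the word $\langle n\rangle_U$ is over the input alphabet and $x_n=\tau(\delta(q_0,\langle n\rangle_U))$; here $\delta$ is extended to words, which are read from left to right. **The automaton.** Let $M_\varphi=(|\varphi(a)|_b)_{a,b\in\mathcal A}$. Call a pair of non-negative integers $(H,L)$ *admissible* if, for all factors $w$ of $\mathbf u$, the sum of the components of $\Psi^{\rm rel}(w)M_\varphi$ has absolute value at most $H$, and $|w|\ge L$ implies $|\varphi(w)|-|w|\ge2\alpha_0+H$. Given $L$, let $$\mathcal S(n)=\{(\Psi^{\rm rel}(u_j\cdots u_{j+n-1}),\,u_j,\,u_{j+n-L}\cdots u_{j+n+L}) : j\ge L\}\qquad(n\ge1).$$ **Theorem.** 1. For all $n\ge1$, $B_{\mathbf u}(n)=\max\{\|\psi-\psi'\|_\infty : \psi,\psi'\in\mathcal P^{\rm rel}(n)\}$. 2. Admissible pairs $(H,L)$ exist. For every admissible pair $(H,L)$ there are an integer $M\ge\alpha_0$, sets $\mathcal S_0=\emptyset,\mathcal S_1,\dots,\mathcal S_M$ and a function $\delta:\{0,\dots,M\}\times\{0,\dots,\alpha_0\}\to\{0,\dots,M\}$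 such that * $\mathcal S_d=\mathcal S(d)$ and $\delta(0,d)=d$ for $1\le d\le\alpha_0$; * for every $n\ge1$ there is $j\ge1$ with $\mathcal S(n)=\mathcal S_j$; * if $n,n'\ge1$, $\langle n'\rangle_U=\langle n\rangle_Ud$ for a digit $d\in\{0,\dots,\alpha_0\}$, and $\mathcal S(n)=\mathcal S_j$, then $\mathcal S(n')=\mathcal S_{\delta(j,d)}$; and such that, with $\mathcal P^{\rm rel}_j$ the set of the first components of the triples in $\mathcal S_j$, for all $n\ge1$ the word $\langle n\rangle_U$ is over $\{0,\dots,\alpha_0\}$ and, with $j=\delta(0,\langle n\rangle_U)$, $$\mathcal P^{\rm rel}(n)=\mathcal P^{\rm rel}_j,\qquad \mathrm{AC}(n)=\#\mathcal P^{\rm rel}_j,\qquad B_{\mathbf u}(n)=\tau_B(j):=\max\{\|\psi-\psi'\|_\infty : \psi,\psi'\in\mathcal P^{\rm rel}_j\},$$ and $F(\mathcal P^{\rm rel}(n))=F(\mathcal P^{\rm rel}_j)$ for every function $F$, with values in any set, that is defined on the sets of integer vectors. So one and the same automaton, with different output functions, computes the abelian complexity, the balance function and every other function of $\mathcal P^{\rm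 rel}(n)$. 3. The sequence $(B_{\mathbf u}(n))_{n\ge1}$ is $U$-automatic, and so is $(F(\mathcal P^{\rm rel}(n)))_{n\ge1}$ for every such function $F$. -/

import Mathlib

universe v

namespace ParryWord

section Words

variable {A : Type}

/-- The factor `u_i u_{i+1} ⋯ u_{i+n-1}` of the infinite word `u`. -/
def block (u : ℕ → A) (i n : ℕ) : List A := (List.range n).map fun k => u (i + k)

/-- The finite word `w` is a factor of the infinite word `u`. -/
def IsFactor (w : List A) (u : ℕ → A) : Prop := ∃ i, w = block u i w.length

/-- The image `φ(w)` of a finite word under a substitution given by the images of letters. -/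
def subst (φ : A → List A) (w : List A) : List A := w.flatMap φ

/-- `φ(u) = u` for an infinite word `u`: the images of the prefixes of `u` are prefixes of `u`.
(This is only used for substitutions with nonempty images of letters.) -/
def IsFixedPoint (φ : A → List A) (u : ℕ → A) : Prop :=
  ∀ n, subst φ (block u 0 n) = block u 0 (subst φ (block u 0 n)).length

/-- The maximum norm of an integer vector, as a natural number. -/
def maxNorm [Fintype A] (x : A → ℤ) : ℕ := Finset.univ.sup fun a => (x a).natAbs

/-- `maxNorm` is Mathlib's maximum norm. -/
theorem coe_maxNorm [Fintype A] (x : A → ℤ) : (maxNorm x : ℝ) = ‖x‖ := by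
  refine le_antisymm ?_ ?_
  · rcases isEmpty_or_nonempty A with h | h
    · simp [maxNorm]
    · obtain ⟨a, -, ha⟩ := Finset.exists_mem_eq_sup Finset.univ Finset.univ_nonempty
        (fun a => (x a).natAbs)
      have h2 := norm_le_pi_norm x a
      rw [maxNorm, ha]
      simpa [Int.norm_eq_abs, Nat.cast_natAbs] using h2
  · refine (pi_norm_le_iff_of_nonneg (Nat.cast_nonneg _)).2 fun a => ?_
    have h1 : (x a).natAbs ≤ maxNorm x :=
      Finset.le_sup (f := fun a => (x a).natAbs) (Finset.mem_univ a)
    have h2 : (((x a).natAbs : ℕ) : ℝ) ≤ (maxNorm x : ℝ) := by exact_mod_cast h1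
    simpa [Int.norm_eq_abs, Nat.cast_natAbs] using h2

variable [DecidableEq A]

/-- The infinite word `u` is `c`-balanced. -/
def IsBalanced (c : ℕ) (u : ℕ → A) : Prop :=
  ∀ v w : List A, IsFactor v u → IsFactor w u → v.length = w.length →
    ∀ a : A, |(v.count a : ℤ) - (w.count a : ℤ)| ≤ (c : ℤ)

/-- The Parikh vector `Ψ(w)`. -/
def parikh (w : List A) : A → ℤ := fun a => (w.count a : ℤ)

/-- The relative Parikh vector of a factor `w` of `u`. -/
def relParikh (u : ℕ → A) (w : List A) : A → ℤ := parikh w - parikh (block u 0 w.length)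

/-- The set of Parikh vectors of the factors of `u` of length `n`. -/
def parikhSet (u : ℕ → A) (n : ℕ) : Set (A → ℤ) :=
  {ψ | ∃ w, IsFactor w u ∧ w.length = n ∧ ψ = parikh w}

/-- The set `𝒫ʳᵉˡ(n)` of relative Parikh vectors of the factors of `u` of length `n`. -/
def relParikhSet (u : ℕ → A) (n : ℕ) : Set (A → ℤ) :=
  {ψ | ∃ w, IsFactor w u ∧ w.length = n ∧ ψ = relParikh u w}

/-- The abelian complexity of `u`. -/
noncomputable def abelianComplexity (u : ℕ → A) (n : ℕ) : ℕ := (parikhSet u n).ncard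

/-- The differences `| |w|_a - |w'|_a |` for letters `a` and factors `w`, `w'` of length `n`. -/
def letterDifferences (u : ℕ → A) (n : ℕ) : Set ℕ :=
  {k | ∃ (a : A) (w w' : List A), IsFactor w u ∧ IsFactor w' u ∧ w.length = n ∧ w'.length = n ∧
    k = ((w.count a : ℤ) - (w'.count a : ℤ)).natAbs}

/-- The balance function of `u`: the maximum of `letterDifferences u n`. -/
noncomputable def balanceFunction (u : ℕ → A) (n : ℕ) : ℕ := sSup (letterDifferences u n)

/-- The supremum in the definition of the balance function is always a maximum. -/
theorem isGreatest_balanceFunction (u : ℕ → A) (n : ℕ) :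
    IsGreatest (letterDifferences u n) (balanceFunction u n) := by
  have hne : (letterDifferences u n).Nonempty :=
    ⟨_, u 0, block u 0 n, block u 0 n, ⟨0, by simp [block]⟩, ⟨0, by simp [block]⟩,
      by simp [block], by simp [block], rfl⟩
  have hbd : BddAbove (letterDifferences u n) := by
    refine ⟨n, ?_⟩
    rintro k ⟨a, w, w', -, -, hw, hw', rfl⟩
    have h1 : w.count a ≤ n := hw ▸ List.count_le_length
    have h2 : w'.count a ≤ n := hw' ▸ List.count_le_length
    omega
  exact ⟨Nat.sSup_mem hne hbd, fun k hk => le_csSup hbd hk⟩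

/-- The set of the distances `‖ψ - ψ'‖_∞` for `ψ, ψ' ∈ P`. -/
def distances [Fintype A] (P : Set (A → ℤ)) : Set ℕ :=
  {k | ∃ ψ ∈ P, ∃ ψ' ∈ P, k = maxNorm (ψ - ψ')}

end Words

section Substitutions

variable {N : ℕ} [NeZero N]

/-- The substitution `i ↦ 0^{α_i} (i+1)` for `i < N - 1`, `N - 1 ↦ 0^{α_{N-1}}`. -/
def simpleSubst (α : Fin N → ℕ) (i : Fin N) : List (Fin N) :=
  List.replicate (α i) 0 ++ if h : i.val + 1 < N then [⟨i.val + 1, h⟩] else []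

/-- The substitution `i ↦ 0^{α_i} (i+1)` for `i < N - 1`, `N - 1 ↦ 0^{α_{N-1}} m`. -/
def nonSimpleSubst (m : Fin N) (α : Fin N → ℕ) (i : Fin N) : List (Fin N) :=
  List.replicate (α i) 0 ++ [if h : i.val + 1 < N then ⟨i.val + 1, h⟩ else m]

/-- The sequence `α_0 α_1 ⋯ α_{N-1} 0 0 0 ⋯`. -/
def simpleExpansion (α : Fin N → ℕ) (i : ℕ) : ℕ := if h : i < N then α ⟨i, h⟩ else 0

/-- The sequence `α_0 ⋯ α_{m-1} (α_m ⋯ α_{N-1})(α_m ⋯ α_{N-1}) ⋯`. -/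
def nonSimpleExpansion (m : Fin N) (α : Fin N → ℕ) (i : ℕ) : ℕ :=
  if h : i < N then α ⟨i, h⟩
  else α ⟨m.val + (i - m.val) % (N - m.val), by
    have := m.isLt
    have := Nat.mod_lt (i - m.val) (show 0 < N - m.val by omega)
    omega⟩

/-- The condition that `t` is lexicographically larger than each of its proper shifts. -/
def IsParryAdmissible (t : ℕ → ℕ) : Prop :=
  ∀ k, 1 ≤ k → toLex (fun i => t (i + k)) < toLex t

/-- `φ` is the substitution of a simple or non-simple Parry number `β > 1` over the alphabet
`{0, …, N - 1}` with the exponents `α`. The condition `2 ≤ N ∨ 2 ≤ α 0` says `β ≠ 1`; it only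
excludes the identity substitution `0 ↦ 0`. -/
def IsParrySubstitution (α : Fin N → ℕ) (φ : Fin N → List (Fin N)) : Prop :=
  1 ≤ α 0 ∧ (∀ i, α i ≤ α 0) ∧
  ((φ = simpleSubst α ∧ IsParryAdmissible (simpleExpansion α) ∧
      1 ≤ α ⟨N - 1, Nat.sub_lt (NeZero.pos N) Nat.one_pos⟩ ∧ (2 ≤ N ∨ 2 ≤ α 0)) ∨
    ∃ m : Fin N, 1 ≤ m.val ∧ φ = nonSimpleSubst m α ∧ IsParryAdmissible (nonSimpleExpansion m α) ∧
      ∃ l : Fin N, m ≤ l ∧ 1 ≤ α l)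

/-- The numbers `U_j = |φ^j(0)|`. -/
def lengths (φ : Fin N → List (Fin N)) (j : ℕ) : ℕ := ((subst φ)^[j] [0]).length

/-- The incidence matrix of `φ`: the row of index `a` is the Parikh vector of `φ(a)`. -/
def incidence (φ : Fin N → List (Fin N)) : Matrix (Fin N) (Fin N) ℤ :=
  Matrix.of fun a b => ((φ a).count b : ℤ)

end Substitutions

/-- The digits `d_{K-1}, …, d_0` (most significant first) that the greedy algorithm, started at
the position `K - 1`, assigns to `n` in the numeration system `U`. -/
def greedyDigits (U : ℕ → ℕ) : ℕ → ℕ → List ℕ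
  | 0, _ => []
  | k + 1, n => (n / U k) :: greedyDigits U k (n % U k)

/-- The normal `U`-representation of `n ≥ 1`: the greedy digits `d_k ⋯ d_0`, where
`U_k ≤ n < U_{k+1}`. -/
noncomputable def normalRep (U : ℕ → ℕ) (n : ℕ) : List ℕ :=
  greedyDigits U (sInf {K | n < U K}) n

/-- A deterministic automaton with output, with states `Q`, input alphabet `I` and output
alphabet `Δ`. -/
structure DFAO (Q : Type) (I : Type) (Δ : Type v) where
  /-- the transition function -/
  step : Q → I → Q
  /-- the initial state -/
  start : Q
  /-- the output function -/
  out : Q → Δ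

/-- The output of the automaton on the input word `w`, which is read from left to right. -/
def DFAO.eval {Q I : Type} {Δ : Type v} (D : DFAO Q I Δ) (w : List I) : Δ :=
  D.out (w.foldl D.step D.start)

/-- The sequence `(x_n)_{n ≥ 1}` is `U`-automatic, with input alphabet `{0, …, b}`. -/
def IsUAutomatic {X : Type v} (U : ℕ → ℕ) (b : ℕ) (x : ℕ → X) : Prop :=
  ∃ (Q : Type) (Δ : Set X) (D : DFAO Q (Fin (b + 1)) Δ), Finite Q ∧ Δ.Finite ∧
    ∀ n, 1 ≤ n → ∃ w : List (Fin (b + 1)),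
      w.map Fin.val = normalRep U n ∧ x n = (D.eval w : X)

section Automaton

variable {N : ℕ} [NeZero N]

/-- `H` bounds the modulus of the sum of the components of `Ψʳᵉˡ(w) M`, for all factors `w`. -/
def IsSumBound (φ : Fin N → List (Fin N)) (u : ℕ → Fin N) (H : ℕ) : Prop :=
  ∀ w, IsFactor w u → |∑ b, (Matrix.vecMul (relParikh u w) (incidence φ)) b| ≤ (H : ℤ)

/-- `|φ(w)| - |w| ≥ 2 α_0 + H` for all factors `w` of length at least `L`. -/
def IsWindowBound (α : Fin N → ℕ) (φ : Fin N → List (Fin N)) (u : ℕ → Fin N) (H L : ℕ) : Prop :=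
  ∀ w, IsFactor w u → L ≤ w.length → w.length + (2 * α 0 + H) ≤ (subst φ w).length

/-- The set `𝒮(n)` of the triples
`(Ψʳᵉˡ(u_j ⋯ u_{j+n-1}), u_j, u_{j+n-L} ⋯ u_{j+n+L})` with `j ≥ L`. -/
def tripleSet (u : ℕ → Fin N) (L n : ℕ) : Set ((Fin N → ℤ) × Fin N × List (Fin N)) :=
  {x | ∃ j, L ≤ j ∧ x = (relParikh u (block u j n), u j, block u (j + n - L) (2 * L + 1))}

/-- The sets `S 0 = ∅, S 1, …, S M` and the transition function `δ` on `{0, …, M}`, with initial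
state `0`, are a transition system for the sets `𝒮(n)`. -/
structure IsTransitionSystem (α : Fin N → ℕ) (φ : Fin N → List (Fin N)) (u : ℕ → Fin N)
    (L M : ℕ) (S : Fin (M + 1) → Set ((Fin N → ℤ) × Fin N × List (Fin N)))
    (δ : Fin (M + 1) → Fin (α 0 + 1) → Fin (M + 1)) : Prop where
  le : α 0 ≤ M
  zero : S 0 = ∅
  small : ∀ j : Fin (M + 1), 1 ≤ j.val → j.val ≤ α 0 → S j = tripleSet u L j.val
  exhaust : ∀ n, 1 ≤ n → ∃ j : Fin (M + 1), j ≠ 0 ∧ tripleSet u L n = S j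
  start : ∀ d : Fin (α 0 + 1), d ≠ 0 → (δ 0 d).val = d.val
  step : ∀ n n' : ℕ, 1 ≤ n → 1 ≤ n' → ∀ d : Fin (α 0 + 1),
    normalRep (lengths φ) n' = normalRep (lengths φ) n ++ [d.val] →
      ∀ j : Fin (M + 1), tripleSet u L n = S j → tripleSet u L n' = S (δ j d)

/-- The set `𝒫ʳᵉˡ_j` of the first components of the triples in a set `𝒮_j`. -/
def firstComponents (S : Set ((Fin N → ℤ) × Fin N × List (Fin N))) : Set (Fin N → ℤ) :=
  Prod.fst '' S

/-- The output function `τ_B`, as a function of the set `𝒫ʳᵉˡ_j`: the maximum of the distances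
`‖ψ - ψ'‖_∞` with `ψ, ψ'` in this set (and `0` if the set is empty). -/
noncomputable def tauB (P : Set (Fin N → ℤ)) : ℕ := sSup (distances P)

end Automaton

end ParryWord

open ParryWord

/-! The normal representation of `n` encodes a factorisation of the prefix of `u` of length `n` into
images `φ^i(0)`. Appending a digit `d` therefore applies `φ` to that prefix and adds `0^d`
(`expand_concat`, `expand_normalRep`, `block_eq_of_normalRep_eq`). The Parry condition enters here:
it makes the greedy digits match prefixes of the iterates `φ^K(0)`.

Let `n'` be the length obtained from `n` and `d`. Every position of `u` is `|φ(u_0 ⋯ u_{j-1})| + i`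
with `i < |φ(u_j)|`. The factor of length `n'` that starts there is compared with `φ(u_j ⋯
u_{j+n-1})`. On the left, `i` letters are removed. On the right, the endpoint is displaced by `i +
d` minus the sum of the components of `Ψʳᵉˡ M`, hence by at most `2 α_0 + H`. Images of long words
are longer than the words by at least this amount, so the new window around the right end lies
inside the image of the old window. Thus each new triple is a function of an old triple, `d` and `i`
(`nextTriple_triple`), and `𝒮(n')` depends only on `𝒮(n)` and `d` (`IsParryData.tripleSet_eq`).

Balance leaves only finitely many possible triples, hence finitely many sets `𝒮(n)`, which serve as
states. Recurrence of `u` makes the restriction `j ≥ L` harmless, so the first components give all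
of `𝒫ʳᵉˡ(n)`. Differences of relative Parikh vectors of factors of equal length are differences of
Parikh vectors, which yields the balance function and the abelian complexity. -/

namespace ParryWord

/-! ### Factors of infinite words and iterated images under a substitution -/

section Blocks

variable {A : Type}

@[simp] theorem length_block (u : ℕ → A) (i n : ℕ) : (block u i n).length = n := by
  simp [block]

@[simp] theorem block_zero (u : ℕ → A) (i : ℕ) : block u i 0 = [] := rfl

@[simp] theorem block_one (u : ℕ → A) (i : ℕ) : block u i 1 = [u i] := by
  simp [block, List.range_succ]

theorem block_add (u : ℕ → A) (i m n : ℕ) :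
    block u i (m + n) = block u i m ++ block u (i + m) n := by
  simp only [block, List.range_add, List.map_append, List.map_map]
  congr 1
  exact List.map_congr_left fun k _ => by simp [add_assoc]

theorem take_block (u : ℕ → A) (i : ℕ) {m n : ℕ} (h : m ≤ n) :
    (block u i n).take m = block u i m := by
  obtain ⟨k, rfl⟩ := Nat.exists_eq_add_of_le h
  rw [block_add, List.take_left' (length_block u i m)]

theorem drop_block (u : ℕ → A) (i m n : ℕ) :
    (block u i n).drop m = block u (i + m) (n - m) := by
  rcases le_total m n with h | h
  · obtain ⟨k, rfl⟩ := Nat.exists_eq_add_of_le h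
    rw [block_add, List.drop_left' (length_block u i m), Nat.add_sub_cancel_left]
  · rw [List.drop_of_length_le (by simpa using h), Nat.sub_eq_zero_of_le h, block_zero]

theorem getElem?_block (u : ℕ → A) (i : ℕ) {k n : ℕ} (h : k < n) :
    (block u i n)[k]? = some (u (i + k)) := by
  simp [block, h]

theorem isFactor_block (u : ℕ → A) (i n : ℕ) : IsFactor (block u i n) u :=
  ⟨i, by rw [length_block]⟩

theorem eq_block_of_prefix {u : ℕ → A} {w v : List A} {i : ℕ} (h : w <+: v)
    (hv : v = block u i v.length) : w = block u i w.length := by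
  conv_lhs => rw [List.prefix_iff_eq_take.1 h, hv, take_block u i h.length_le]

@[simp] theorem subst_nil (φ : A → List A) : subst φ [] = [] := rfl

theorem subst_cons (φ : A → List A) (a : A) (w : List A) :
    subst φ (a :: w) = φ a ++ subst φ w := rfl

@[simp] theorem subst_append (φ : A → List A) (v w : List A) :
    subst φ (v ++ w) = subst φ v ++ subst φ w := by
  simp [subst]

@[simp] theorem subst_singleton (φ : A → List A) (a : A) : subst φ [a] = φ a := by
  simp [subst]

theorem subst_iterate_append (φ : A → List A) (k : ℕ) (v w : List A) :
    (subst φ)^[k] (v ++ w) = (subst φ)^[k] v ++ (subst φ)^[k] w := by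
  induction k generalizing v w with
  | zero => rfl
  | succ k ih => simp [ih]

theorem subst_iterate_nil (φ : A → List A) (k : ℕ) : (subst φ)^[k] [] = [] :=
  Function.iterate_fixed rfl k

theorem length_subst_iterate_replicate (φ : A → List A) (k d : ℕ) (a : A) :
    ((subst φ)^[k] (List.replicate d a)).length = d * ((subst φ)^[k] [a]).length := by
  induction d with
  | zero => simp [subst_iterate_nil]
  | succ d ih =>
    rw [List.replicate_succ', subst_iterate_append, List.length_append, ih]
    ring

theorem subst_iterate_replicate_prefix (φ : A → List A) (k : ℕ) {c d : ℕ} (a : A) (h : c < d) :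
    (subst φ)^[k] (List.replicate c a) ++ (subst φ)^[k] [a] <+:
      (subst φ)^[k] (List.replicate d a) := by
  obtain ⟨r, rfl⟩ := Nat.exists_eq_add_of_lt h
  rw [show c + r + 1 = (c + 1) + r by ring, List.replicate_add, List.replicate_succ',
    subst_iterate_append, subst_iterate_append]
  exact List.prefix_append _ _

theorem length_le_length_subst {φ : A → List A} (h : ∀ a, φ a ≠ []) (w : List A) :
    w.length ≤ (subst φ w).length := by
  induction w with
  | nil => simp
  | cons a w ih =>
    have h1 := List.length_pos_iff.2 (h a)
    rw [subst_cons, List.length_append, List.length_cons]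
    omega

theorem length_le_length_subst_iterate {φ : A → List A} (h : ∀ a, φ a ≠ []) (k : ℕ)
    (w : List A) : w.length ≤ ((subst φ)^[k] w).length := by
  induction k with
  | zero => rfl
  | succ k ih =>
    rw [Function.iterate_succ_apply']
    exact ih.trans (length_le_length_subst h _)

theorem IsFixedPoint.iterate {φ : A → List A} {u : ℕ → A} (hu : IsFixedPoint φ u) (k n : ℕ) :
    (subst φ)^[k] (block u 0 n) = block u 0 ((subst φ)^[k] (block u 0 n)).length := by
  induction k with
  | zero => simp
  | succ k ih =>
    rw [Function.iterate_succ_apply', ih]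
    exact hu _

end Blocks

/-! ### Parry expansions and greedy representations -/

section Expansions

variable {N : ℕ} [NeZero N]

/-- The combinatorial data of a Parry substitution `φ`: the expansion `t` and words `e k`, each of
which is a letter or empty, with `φ(e k) = 0^{t k} e (k + 1)`. -/
structure IsParryData (b : ℕ) (φ : Fin N → List (Fin N)) (t : ℕ → ℕ)
    (e : ℕ → List (Fin N)) : Prop where
  map_eq : ∀ k, subst φ (e k) = List.replicate (t k) 0 ++ e (k + 1)
  letter : ∀ a : Fin N, e a = [a]
  antitone : Antitone fun k => (e k).length
  admissible : IsParryAdmissible t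
  le : ∀ k, t k ≤ b
  reach : ∀ a : Fin N, ∃ i, t (a + i) ≠ 0
  ne_nil : ∀ a, φ a ≠ []
  two_le : 2 ≤ (φ 0).length

/-- Puts the simple and non-simple cases on the same footing: beyond `N - 1`, the word `e k` is
empty in the simple case, and in the non-simple case it is the letter obtained by folding `k` into
the cycle `m, …, N - 1`. -/
theorem IsParrySubstitution.exists_isParryData {α : Fin N → ℕ} {φ : Fin N → List (Fin N)}
    (h : IsParrySubstitution α φ) : ∃ t e, IsParryData (α 0) φ t e := by
  obtain ⟨h0, hle, ⟨rfl, hadm, hlast, htwo⟩ | ⟨m, hm, rfl, hadm, l, hml, hl⟩⟩ := h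
  · have hne : ∀ a, simpleSubst α a ≠ [] := by
      intro a
      unfold simpleSubst
      split_ifs with ha
      · simp
      · have : a = ⟨N - 1, Nat.sub_lt (NeZero.pos N) Nat.one_pos⟩ :=
          Fin.ext (by have := a.isLt; simp; omega)
        rw [this]
        simp
        omega
    refine ⟨simpleExpansion α, fun k => if h : k < N then [⟨k, h⟩] else [], ?_, ?_, ?_, hadm, ?_,
      ?_, hne, ?_⟩
    · intro k
      by_cases hk : k < N
      · simp [hk, simpleSubst, simpleExpansion]
      · have : ¬ k + 1 < N := by omega
        simp [hk, this, simpleExpansion]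
    · intro a
      simp
    · intro i j hij
      dsimp only
      split_ifs with h1 h2
      · simp
      · omega
      · simp
      · simp
    · intro k
      unfold simpleExpansion
      split_ifs
      · exact hle _
      · exact Nat.zero_le _
    · intro a
      have := a.isLt
      refine ⟨N - 1 - a, ?_⟩
      have h1 : (a : ℕ) + (N - 1 - a) = N - 1 := by omega
      rw [h1, simpleExpansion, dif_pos (Nat.sub_lt (NeZero.pos N) Nat.one_pos)]
      omega
    · unfold simpleSubst
      split_ifs with h1
      · simp
        omega
      · simp at h1 ⊢
        omega
  · have hmN := m.isLt
    have hm0 : 0 < N - m := by omega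
    have hlt : ∀ k : ℕ, m.val + (k - m.val) % (N - m.val) < N := fun k => by
      have := Nat.mod_lt (k - m.val) hm0
      omega
    have hexp : ∀ k, nonSimpleExpansion m α k =
        α (if h : k < N then ⟨k, h⟩ else ⟨m.val + (k - m.val) % (N - m.val), hlt k⟩) := by
      intro k
      unfold nonSimpleExpansion
      split_ifs <;> rfl
    refine ⟨nonSimpleExpansion m α, fun k => [if h : k < N then ⟨k, h⟩ else
      ⟨m.val + (k - m.val) % (N - m.val), hlt k⟩], ?_, ?_, ?_, hadm, ?_, ?_, ?_, ?_⟩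
    · intro k
      rw [hexp, subst_singleton, nonSimpleSubst]
      congr 2
      by_cases h1 : k + 1 < N
      · have h2 : k < N := by omega
        simp [h1, h2]
      · by_cases h2 : k < N
        · have h3 : k + 1 - m.val = N - m.val := by omega
          simp [h1, h2, h3]
        · have h3 : k + 1 - m.val = (k - m.val) + 1 := by omega
          have h4 := Nat.mod_lt (k - m.val) hm0
          by_cases h5 : (k - m.val) % (N - m.val) + 1 < N - m.val
          · have h6 : (k + 1 - m.val) % (N - m.val) = (k - m.val) % (N - m.val) + 1 := by
              rw [h3, Nat.add_mod, Nat.mod_eq_of_lt (a := 1) (by omega), Nat.mod_eq_of_lt h5]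
            have h7 : m.val + (k - m.val) % (N - m.val) + 1 < N := by omega
            simp only [h1, h2, h6, h7, dite_true, dite_false]
            rfl
          · have h6 : (k + 1 - m.val) % (N - m.val) = 0 := by
              rw [h3, ← Nat.mod_add_mod,
                show (k - m.val) % (N - m.val) + 1 = N - m.val by omega, Nat.mod_self]
            have h7 : ¬ m.val + (k - m.val) % (N - m.val) + 1 < N := by omega
            simp [h1, h2, h6, h7]
    · intro a
      simp
    · intro i j _
      simp
    · intro k
      rw [hexp]
      exact hle _
    · intro a
      have := a.isLt
      have hml' : m.val ≤ l.val := hml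
      have := l.isLt
      refine ⟨l.val + (N - m.val) - a, ?_⟩
      have h1 : (a : ℕ) + (l.val + (N - m.val) - a) = l.val + (N - m.val) := by omega
      have h2 : ¬ l.val + (N - m.val) < N := by omega
      rw [h1, hexp, dif_neg h2]
      have h3 : (l.val + (N - m.val) - m.val) % (N - m.val) = l.val - m.val := by
        rw [show l.val + (N - m.val) - m.val = l.val - m.val + (N - m.val) by omega,
          Nat.add_mod_right, Nat.mod_eq_of_lt (by omega)]
      have h4 : (⟨m.val + (l.val + (N - m.val) - m.val) % (N - m.val), hlt _⟩ : Fin N) = l :=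
        Fin.ext (by simp only [h3]; omega)
      rw [h4]
      omega
    · intro a
      simp [nonSimpleSubst]
    · simp [nonSimpleSubst]
      omega

/-- The word `φ^k(0)^{d_k} ⋯ φ^0(0)^{d_0}` of a digit word `d_k ⋯ d_0`. -/
def expand (φ : Fin N → List (Fin N)) : List ℕ → List (Fin N)
  | [] => []
  | d :: l => (subst φ)^[l.length] (List.replicate d 0) ++ expand φ l

/-- Horner's rule: a new last digit raises every earlier exponent of `φ` by one. -/
theorem expand_concat (φ : Fin N → List (Fin N)) (l : List ℕ) (d : ℕ) :
    expand φ (l ++ [d]) = subst φ (expand φ l) ++ List.replicate d 0 := by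
  induction l with
  | nil => simp [expand]
  | cons c l ih =>
    simp only [List.cons_append, expand, ih, List.length_append, List.length_singleton,
      Function.iterate_succ_apply', subst_append, List.append_assoc]

theorem lengths_zero (φ : Fin N → List (Fin N)) : lengths φ 0 = 1 := rfl

theorem length_expand_cons (φ : Fin N → List (Fin N)) (d : ℕ) (l : List ℕ) :
    (expand φ (d :: l)).length = d * lengths φ l.length + (expand φ l).length := by
  rw [expand, List.length_append, length_subst_iterate_replicate, lengths]

/-- The digit words that are admissible from the state `k` on: each digit is that of the
expansion `t`, or a smaller one, after which the comparison starts again. -/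
def AdmissibleDigits (t : ℕ → ℕ) (e : ℕ → List (Fin N)) : ℕ → List ℕ → Prop
  | k, [] => e k ≠ []
  | k, d :: l => (d < t k ∧ AdmissibleDigits t e 0 l) ∨ (d = t k ∧ AdmissibleDigits t e (k + 1) l)

@[simp] theorem length_greedyDigits (U : ℕ → ℕ) (K n : ℕ) : (greedyDigits U K n).length = K := by
  induction K generalizing n with
  | zero => rfl
  | succ K ih => simp [greedyDigits, ih]

namespace IsParryData

variable {b : ℕ} {φ : Fin N → List (Fin N)} {t : ℕ → ℕ} {e : ℕ → List (Fin N)}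

theorem e_zero (h : IsParryData b φ t e) : e 0 = [0] := by
  simpa using h.letter 0

theorem length_e_le (h : IsParryData b φ t e) (k : ℕ) : (e k).length ≤ 1 := by
  have := h.antitone (Nat.zero_le k)
  simpa [h.e_zero] using this

theorem lengths_eq (h : IsParryData b φ t e) (K : ℕ) :
    lengths φ K = ((subst φ)^[K] (e 0)).length := by
  rw [lengths, h.e_zero]

theorem map_letter (h : IsParryData b φ t e) (a : Fin N) :
    φ a = List.replicate (t a) 0 ++ e (a + 1) := by
  rw [← h.map_eq, h.letter, subst_singleton]

theorem length_map_le (h : IsParryData b φ t e) (a : Fin N) : (φ a).length ≤ b + 1 := by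
  have h1 := h.le a
  have h2 := h.length_e_le (a + 1)
  rw [h.map_letter a, List.length_append, List.length_replicate]
  omega

theorem length_iterate_succ (h : IsParryData b φ t e) (K k : ℕ) :
    ((subst φ)^[K + 1] (e k)).length =
      t k * lengths φ K + ((subst φ)^[K] (e (k + 1))).length := by
  rw [Function.iterate_succ_apply, h.map_eq, subst_iterate_append, List.length_append,
    length_subst_iterate_replicate, lengths]

/-- A smaller first digit loses at least one copy of `U_K`, and the remaining tail cannot make up
for it, since admissibility bounds the tail by `U_K`. With equal first digits the comparison passes
to the shifted sequences. The condition `j ≤ k` serves the base case, where only the lengths of `e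
j` and `e k` count. -/
theorem length_iterate_le_of_lex (h : IsParryData b φ t e) (K : ℕ) : ∀ j k, j ≤ k →
    toLex (fun i => t (i + k)) ≤ toLex (fun i => t (i + j)) →
      ((subst φ)^[K] (e k)).length ≤ ((subst φ)^[K] (e j)).length := by
  induction K with
  | zero => exact fun j k hjk _ => h.antitone hjk
  | succ K ih =>
    intro j k hjk hlex
    have h0 : ((subst φ)^[K] (e (k + 1))).length ≤ lengths φ K := by
      rw [h.lengths_eq]
      exact ih 0 (k + 1) (Nat.zero_le _) (h.admissible (k + 1) (by omega)).le
    rw [h.length_iterate_succ, h.length_iterate_succ]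
    have key : t k < t j ∨ (t k = t j ∧
        toLex (fun i => t (i + (k + 1))) ≤ toLex (fun i => t (i + (j + 1)))) := by
      rcases hlex.lt_or_eq with hlt | heq
      · obtain ⟨i, hi, hi'⟩ := hlt
        cases i with
        | zero => exact Or.inl (by simpa using hi')
        | succ i =>
          refine Or.inr ⟨by simpa using hi 0 (Nat.succ_pos i), le_of_lt ⟨i, fun r hr => ?_, ?_⟩⟩
          · have := hi (r + 1) (by omega)
            simpa [add_assoc, add_comm, add_left_comm] using this
          · simpa [add_assoc, add_comm, add_left_comm] using hi'
      · have heq' : ∀ i, t (i + k) = t (i + j) := fun i => congrFun (toLex.injective heq) i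
        refine Or.inr ⟨by simpa using heq' 0, le_of_eq (congrArg toLex (funext fun i => ?_))⟩
        have := heq' (i + 1)
        simpa [add_assoc, add_comm, add_left_comm] using this
    rcases key with hlt | ⟨heq, htail⟩
    · have h1 : (t k + 1) * lengths φ K ≤ t j * lengths φ K := Nat.mul_le_mul_right _ hlt
      rw [add_one_mul] at h1
      omega
    · have := ih (j + 1) (k + 1) (by omega) htail
      rw [heq]
      omega

theorem length_iterate_le (h : IsParryData b φ t e) (K k : ℕ) :
    ((subst φ)^[K] (e k)).length ≤ lengths φ K := by
  rw [h.lengths_eq]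
  rcases Nat.eq_zero_or_pos k with rfl | hk
  · rfl
  · exact h.length_iterate_le_of_lex K 0 k hk.le (h.admissible k hk).le

theorem lengths_pos (h : IsParryData b φ t e) (K : ℕ) : 0 < lengths φ K :=
  length_le_length_subst_iterate h.ne_nil K [0]

/-- The bound on `n` is `t k * U_K` plus a tail that is at most `U_K`, so the first greedy digit is
at most `t k`; if it equals `t k`, the remainder lies below the tail and the comparison continues at
`k + 1`. -/
theorem admissibleDigits_greedyDigits (h : IsParryData b φ t e) (K : ℕ) : ∀ k n,
    n < ((subst φ)^[K] (e k)).length →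
      AdmissibleDigits t e k (greedyDigits (lengths φ) K n) := by
  induction K with
  | zero =>
    intro k n hn hk
    simp [hk] at hn
  | succ K ih =>
    intro k n hn
    rw [h.length_iterate_succ] at hn
    have hU := h.lengths_pos K
    have hV := h.length_iterate_le K (k + 1)
    have hdiv := Nat.div_add_mod n (lengths φ K)
    have hmod := Nat.mod_lt n hU
    rcases lt_trichotomy (n / lengths φ K) (t k) with h1 | h1 | h1
    · exact Or.inl ⟨h1, ih 0 _ (by rwa [← h.lengths_eq])⟩
    · refine Or.inr ⟨h1, ih (k + 1) _ ?_⟩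
      rw [h1, mul_comm] at hdiv
      omega
    · have h2 : (t k + 1) * lengths φ K ≤ n / lengths φ K * lengths φ K :=
        Nat.mul_le_mul_right _ h1
      rw [add_one_mul] at h2
      rw [mul_comm] at hdiv
      omega

/-- If the first digit is below `t k`, there is room for one more copy of `φ^K(0)`, and the rest of
the expansion is a proper prefix of that copy. If it equals `t k`, the rest continues inside `φ^K(e
(k + 1))`. -/
theorem expand_prefix (h : IsParryData b φ t e) (l : List ℕ) : ∀ k, AdmissibleDigits t e k l →
    expand φ l <+: (subst φ)^[l.length] (e k) ∧
      (expand φ l).length < ((subst φ)^[l.length] (e k)).length := by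
  induction l with
  | nil => exact fun k hk => ⟨List.nil_prefix, List.length_pos_iff.2 hk⟩
  | cons d l ih =>
    intro k hk
    rw [length_expand_cons, List.length_cons, h.length_iterate_succ, Function.iterate_succ_apply,
      h.map_eq, subst_iterate_append, expand]
    rcases hk with ⟨hd, hl⟩ | ⟨rfl, hl⟩
    · obtain ⟨h1, h2⟩ := ih 0 hl
      rw [h.e_zero] at h1 h2
      refine ⟨?_, ?_⟩
      · exact ((List.prefix_append_right_inj _).2 h1).trans
          ((subst_iterate_replicate_prefix φ _ _ hd).trans (List.prefix_append _ _))
      · have h3 : (d + 1) * lengths φ l.length ≤ t k * lengths φ l.length :=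
          Nat.mul_le_mul_right _ hd
        rw [add_one_mul] at h3
        rw [← lengths] at h2
        omega
    · obtain ⟨h1, h2⟩ := ih (k + 1) hl
      exact ⟨(List.prefix_append_right_inj _).2 h1, by omega⟩

theorem length_expand_lt (h : IsParryData b φ t e) {l : List ℕ} {k : ℕ}
    (hl : AdmissibleDigits t e k l) : (expand φ l).length < lengths φ l.length :=
  (h.expand_prefix l k hl).2.trans_le (h.length_iterate_le _ _)

theorem greedyDigits_length_expand (h : IsParryData b φ t e) (l : List ℕ) : ∀ k,
    AdmissibleDigits t e k l →
      greedyDigits (lengths φ) l.length (expand φ l).length = l := by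
  induction l with
  | nil => exact fun _ _ => rfl
  | cons d l ih =>
    intro k hk
    obtain ⟨k', hk'⟩ : ∃ k', AdmissibleDigits t e k' l := by
      rcases hk with ⟨-, hl⟩ | ⟨-, hl⟩
      exacts [⟨_, hl⟩, ⟨_, hl⟩]
    have h1 := h.length_expand_lt hk'
    rw [length_expand_cons, List.length_cons, greedyDigits, mul_comm,
      Nat.mul_add_mod, Nat.mod_eq_of_lt h1, ih k' hk', Nat.mul_add_div (h.lengths_pos _),
      Nat.div_eq_of_lt h1, add_zero]

theorem length_expand_greedyDigits (h : IsParryData b φ t e) (K : ℕ) : ∀ n, n < lengths φ K →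
    (expand φ (greedyDigits (lengths φ) K n)).length = n := by
  induction K with
  | zero =>
    intro n hn
    rw [lengths_zero] at hn
    simp [greedyDigits, expand]
    omega
  | succ K ih =>
    intro n _
    rw [greedyDigits, length_expand_cons, length_greedyDigits,
      ih _ (Nat.mod_lt _ (h.lengths_pos K)), mul_comm, Nat.div_add_mod]

theorem admissibleDigits_of_concat (h : IsParryData b φ t e) (l : List ℕ) (d : ℕ) : ∀ k,
    AdmissibleDigits t e k (l ++ [d]) → AdmissibleDigits t e k l := by
  induction l with
  | nil =>
    -- An empty `e k` forces `t k = 0` and `e (k + 1)` empty, so no digit could have been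
    -- admissible.
    intro k hk hek
    have h1 := h.map_eq k
    rw [hek, subst_nil] at h1
    have h2 := congrArg List.length h1
    simp at h2
    rcases hk with ⟨h3, -⟩ | ⟨-, h3⟩
    · omega
    · exact h3 (List.length_eq_zero_iff.1 (by omega))
  | cons c l ih =>
    rintro k (⟨h1, h2⟩ | ⟨h1, h2⟩)
    · exact Or.inl ⟨h1, ih _ h2⟩
    · exact Or.inr ⟨h1, ih _ h2⟩

theorem le_of_mem_admissibleDigits (h : IsParryData b φ t e) (l : List ℕ) : ∀ k,
    AdmissibleDigits t e k l → ∀ d ∈ l, d ≤ b := by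
  induction l with
  | nil => simp
  | cons c l ih =>
    intro k hk d hd
    have h1 := h.le k
    rcases hk with ⟨h2, h3⟩ | ⟨h2, h3⟩ <;> rcases List.mem_cons.1 hd with rfl | h4
    · omega
    · exact ih _ h3 d h4
    · omega
    · exact ih _ h3 d h4

/-- No letter is erased and each `0` gains at least one letter. This growth makes `U` strictly
increasing and provides the window bound. -/
theorem length_add_count_le (h : IsParryData b φ t e) (w : List (Fin N)) :
    w.length + w.count 0 ≤ (subst φ w).length := by
  induction w with
  | nil => simp
  | cons a w ih =>
    have h1 := List.length_pos_iff.2 (h.ne_nil a)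
    have h2 := h.two_le
    rw [subst_cons, List.length_append, List.length_cons, List.count_cons]
    by_cases ha : a = 0
    · subst ha
      rw [if_pos (by simp)]
      omega
    · rw [if_neg (by simpa using ha)]
      omega

/-- Iterating `φ` moves the last letter along the expansion, and a `0` is produced at the first
nonzero digit from `a` on. -/
theorem exists_zero_mem_iterate (h : IsParryData b φ t e) (a : Fin N) :
    ∃ i, 0 ∈ (subst φ)^[i] [a] := by
  obtain ⟨i, hi⟩ := h.reach a
  rw [← h.letter]
  generalize (a : ℕ) = k at hi
  induction i generalizing k with
  | zero => exact ⟨1, by simp [h.map_eq]; exact Or.inl (by simpa using hi)⟩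
  | succ i ih =>
    by_cases hk : t k = 0
    · obtain ⟨r, hr⟩ := ih (k + 1) (by rwa [add_assoc, add_comm 1 i])
      exact ⟨r + 1, by simpa [h.map_eq, hk] using hr⟩
    · exact ⟨1, by simp [h.map_eq, hk]⟩

section FixedPoint

variable {u : ℕ → Fin N}

/-- The word `φ(u_0)` begins with `u_0`, and with `0` if `t (u 0) ≠ 0`. Otherwise `φ(u_0)` is the
single letter `u_0`, so all iterates equal it, although one of them contains `0`. -/
theorem fixedPoint_zero (h : IsParryData b φ t e) (hu : IsFixedPoint φ u) : u 0 = 0 := by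
  have h1 := hu 1
  rw [block_one, subst_singleton] at h1
  have hpos := List.length_pos_iff.2 (h.ne_nil (u 0))
  have h2 : (φ (u 0))[0]? = some (u 0) := by
    rw [h1, getElem?_block u 0 hpos]
  rw [h.map_letter] at h2
  by_cases ht : t (u 0) = 0
  · have h3 : φ (u 0) = e (u 0 + 1) := by simpa [ht] using h.map_letter (u 0)
    have h4 : φ (u 0) = [u 0] := by
      have h5 : (φ (u 0)).length = 1 := by
        have := h.length_e_le (u 0 + 1)
        rw [← h3] at this
        omega
      rw [h1, h5, block_one]
    obtain ⟨i, hi⟩ := h.exists_zero_mem_iterate (u 0)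
    rw [Function.iterate_fixed (by rw [subst_singleton, h4])] at hi
    exact (List.mem_singleton.1 hi).symm
  · rw [List.getElem?_append_left (by simp; omega)] at h2
    simp [List.getElem?_replicate] at h2
    exact h2.2.symm

theorem iterate_zero_eq_block (h : IsParryData b φ t e) (hu : IsFixedPoint φ u) (K : ℕ) :
    (subst φ)^[K] [0] = block u 0 (lengths φ K) := by
  have := hu.iterate K 1
  rwa [block_one, h.fixedPoint_zero hu] at this

theorem strictMono_lengths (h : IsParryData b φ t e) (hu : IsFixedPoint φ u) :
    StrictMono (lengths φ) := by
  refine strictMono_nat_of_lt_succ fun K => ?_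
  have h1 := h.length_add_count_le ((subst φ)^[K] [0])
  rw [← Function.iterate_succ_apply' (subst φ), ← lengths, ← lengths] at h1
  have h2 : 0 < ((subst φ)^[K] [0]).count 0 := by
    rw [List.count_pos_iff, h.iterate_zero_eq_block hu]
    have := getElem?_block u 0 (h.lengths_pos K)
    rw [zero_add, h.fixedPoint_zero hu] at this
    exact List.mem_of_getElem? this
  rw [Nat.succ_eq_add_one] at h1
  omega

theorem lt_lengths_sInf (h : IsParryData b φ t e) (hu : IsFixedPoint φ u) (n : ℕ) :
    n < lengths φ (sInf {K | n < lengths φ K}) :=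
  Nat.sInf_mem (s := {K | n < lengths φ K})
    ⟨n + 1, (Nat.lt_succ_self n).trans_le ((h.strictMono_lengths hu).le_apply)⟩

theorem admissibleDigits_normalRep (h : IsParryData b φ t e) (hu : IsFixedPoint φ u) (n : ℕ) :
    AdmissibleDigits t e 0 (normalRep (lengths φ) n) :=
  h.admissibleDigits_greedyDigits _ 0 n (by rw [← h.lengths_eq]; exact h.lt_lengths_sInf hu n)

theorem length_expand_normalRep (h : IsParryData b φ t e) (hu : IsFixedPoint φ u) (n : ℕ) :
    (expand φ (normalRep (lengths φ) n)).length = n :=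
  h.length_expand_greedyDigits _ n (h.lt_lengths_sInf hu n)

theorem expand_normalRep (h : IsParryData b φ t e) (hu : IsFixedPoint φ u) (n : ℕ) :
    expand φ (normalRep (lengths φ) n) = block u 0 n := by
  have h1 := (h.expand_prefix _ 0 (h.admissibleDigits_normalRep hu n)).1
  rw [h.e_zero, h.iterate_zero_eq_block hu] at h1
  have h2 := eq_block_of_prefix h1 (by rw [length_block])
  rwa [h.length_expand_normalRep hu] at h2

theorem normalRep_eq_cons (h : IsParryData b φ t e) (hu : IsFixedPoint φ u) {n : ℕ}
    (hn : 1 ≤ n) : ∃ d l, d ≠ 0 ∧ normalRep (lengths φ) n = d :: l := by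
  unfold normalRep
  rcases hK : sInf {K | n < lengths φ K} with _ | K
  · have h1 := h.lt_lengths_sInf hu n
    rw [hK, lengths_zero] at h1
    omega
  · have h1 : K ∉ {K | n < lengths φ K} := Nat.notMem_of_lt_sInf (by omega)
    simp only [Set.mem_ofPred_eq, not_lt] at h1
    exact ⟨_, _, (Nat.div_pos h1 (h.lengths_pos K)).ne', rfl⟩

/-- The nonzero leading digit forces the greedy algorithm to start exactly at the length of the
word. -/
theorem normalRep_length_expand (h : IsParryData b φ t e) (hu : IsFixedPoint φ u) {d : ℕ}
    {l : List ℕ} (hd : d ≠ 0) (hl : AdmissibleDigits t e 0 (d :: l)) :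
    normalRep (lengths φ) (expand φ (d :: l)).length = d :: l := by
  have hK : sInf {K | (expand φ (d :: l)).length < lengths φ K} = (d :: l).length := by
    refine le_antisymm (Nat.sInf_le (h.length_expand_lt hl)) ?_
    by_contra! hlt
    have h1 := h.lt_lengths_sInf hu (expand φ (d :: l)).length
    have h2 : lengths φ (sInf {K | (expand φ (d :: l)).length < lengths φ K}) ≤
        lengths φ l.length :=
      (h.strictMono_lengths hu).monotone (by simpa [Nat.lt_succ_iff] using hlt)
    have h3 : 1 * lengths φ l.length ≤ d * lengths φ l.length :=
      Nat.mul_le_mul_right _ (by omega)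
    have h4 := length_expand_cons φ d l
    omega
  rw [normalRep, hK]
  exact h.greedyDigits_length_expand _ 0 hl

/-- If `⟨n'⟩ = ⟨n⟩d`, then the prefix of length `n'` is the image of the prefix of length `n`,
followed by `0^d`. -/
theorem block_eq_of_normalRep_eq (h : IsParryData b φ t e) (hu : IsFixedPoint φ u) {n n' d : ℕ}
    (hn : normalRep (lengths φ) n' = normalRep (lengths φ) n ++ [d]) :
    block u 0 n' = subst φ (block u 0 n) ++ List.replicate d 0 := by
  rw [← h.expand_normalRep hu n', hn, expand_concat, h.expand_normalRep hu n]

end FixedPoint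

end IsParryData

end Expansions

/-! ### Relative Parikh vectors and the balance function -/

section Parikh

variable {A : Type} [DecidableEq A]

@[simp] theorem parikh_nil : parikh ([] : List A) = 0 := by
  ext a
  simp [parikh]

@[simp] theorem parikh_append (v w : List A) : parikh (v ++ w) = parikh v + parikh w := by
  ext a
  simp [parikh]

theorem parikh_singleton (a : A) : parikh [a] = Pi.single a 1 := by
  ext b
  by_cases h : a = b
  · subst h
    simp [parikh]
  · simp [parikh, h, Ne.symm h]

theorem parikh_replicate (d : ℕ) (a : A) : parikh (List.replicate d a) = Pi.single a (d : ℤ) := by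
  ext b
  by_cases h : a = b
  · subst h
    simp [parikh]
  · simp [parikh, List.count_replicate, h, Ne.symm h]

theorem sum_parikh [Fintype A] (w : List A) : ∑ a, parikh w a = w.length := by
  induction w with
  | nil => simp
  | cons a w ih =>
    rw [← List.singleton_append, parikh_append, parikh_singleton]
    simp only [Pi.add_apply, Finset.sum_add_distrib, ih, Finset.sum_pi_single', Finset.mem_univ,
      if_true, List.length_append, List.length_singleton, Nat.cast_add, Nat.cast_one]

theorem parikh_block (u : ℕ → A) (i n : ℕ) :
    parikh (block u i n) = parikh (block u 0 (i + n)) - parikh (block u 0 i) := by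
  rw [block_add, parikh_append, zero_add, add_sub_cancel_left]

theorem relParikh_block (u : ℕ → A) (i n : ℕ) : relParikh u (block u i n) =
    parikh (block u 0 (i + n)) - parikh (block u 0 i) - parikh (block u 0 n) := by
  rw [relParikh, length_block, parikh_block]

theorem IsBalanced.abs_relParikh_le {c : ℕ} {u : ℕ → A} (hc : IsBalanced c u) {w : List A}
    (hw : IsFactor w u) (a : A) : |relParikh u w a| ≤ (c : ℤ) :=
  hc w _ hw (isFactor_block u 0 w.length) (by simp) a

theorem relParikh_sub (u : ℕ → A) {v w : List A} (h : v.length = w.length) :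
    relParikh u v - relParikh u w = parikh v - parikh w := by
  rw [relParikh, relParikh, h, sub_sub_sub_cancel_right]

theorem relParikhSet_eq_image (u : ℕ → A) (n : ℕ) :
    relParikhSet u n = (fun ψ => ψ - parikh (block u 0 n)) '' parikhSet u n := by
  ext ψ
  constructor
  · rintro ⟨w, hw, rfl, rfl⟩
    exact ⟨_, ⟨w, hw, rfl, rfl⟩, rfl⟩
  · rintro ⟨_, ⟨w, hw, rfl, rfl⟩, rfl⟩
    exact ⟨w, hw, rfl, rfl⟩

theorem abelianComplexity_eq (u : ℕ → A) (n : ℕ) :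
    abelianComplexity u n = (relParikhSet u n).ncard := by
  rw [relParikhSet_eq_image, Set.ncard_image_of_injective _ sub_left_injective, abelianComplexity]

/-- The common prefix vector cancels in differences, and a pair of factors with the largest
difference in one letter also realises the largest norm. -/
theorem isGreatest_distances [Fintype A] (u : ℕ → A) (n : ℕ) :
    IsGreatest (distances (relParikhSet u n)) (balanceFunction u n) := by
  have hg := isGreatest_balanceFunction u n
  have hle : ∀ k ∈ distances (relParikhSet u n), k ≤ balanceFunction u n := by
    rintro k ⟨_, ⟨v, hv, hvn, rfl⟩, _, ⟨w, hw, hwn, rfl⟩, rfl⟩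
    rw [relParikh_sub u (hvn.trans hwn.symm)]
    exact Finset.sup_le fun a _ => hg.2 ⟨a, v, w, hv, hw, hvn, hwn, rfl⟩
  refine ⟨?_, hle⟩
  obtain ⟨a, v, w, hv, hw, hvn, hwn, heq⟩ := hg.1
  have hmem : maxNorm (relParikh u v - relParikh u w) ∈ distances (relParikhSet u n) :=
    ⟨_, ⟨v, hv, hvn, rfl⟩, _, ⟨w, hw, hwn, rfl⟩, rfl⟩
  refine (le_antisymm ?_ (hle _ hmem)) ▸ hmem
  rw [heq, relParikh_sub u (hvn.trans hwn.symm)]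
  exact Finset.le_sup (f := fun a => ((parikh v - parikh w) a).natAbs) (Finset.mem_univ a)

end Parikh

/-! ### The incidence matrix and the constant `H` -/

section Incidence

variable {N : ℕ}

theorem parikh_subst (φ : Fin N → List (Fin N)) (w : List (Fin N)) :
    parikh (subst φ w) = Matrix.vecMul (parikh w) (incidence φ) := by
  induction w with
  | nil => simp
  | cons a w ih =>
    rw [subst_cons, ← List.singleton_append, parikh_append, parikh_append, Matrix.add_vecMul, ih,
      parikh_singleton, Matrix.single_one_vecMul]
    rfl

theorem sum_vecMul_incidence (φ : Fin N → List (Fin N)) (x : Fin N → ℤ) :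
    ∑ b, Matrix.vecMul x (incidence φ) b = ∑ a, x a * ((φ a).length : ℤ) := by
  simp only [Matrix.vecMul, dotProduct]
  rw [Finset.sum_comm]
  refine Finset.sum_congr rfl fun a _ => ?_
  rw [← Finset.mul_sum, ← sum_parikh]
  rfl

theorem IsBalanced.exists_isSumBound {c : ℕ} {u : ℕ → Fin N} [NeZero N] (hc : IsBalanced c u)
    (φ : Fin N → List (Fin N)) : ∃ H, IsSumBound φ u H := by
  -- Balance bounds each component of the relative Parikh vector by `c`, and row `a` of the matrix
  -- has sum `|φ(a)|`.
  refine ⟨∑ a, c * (φ a).length, fun w hw => ?_⟩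
  rw [sum_vecMul_incidence]
  push_cast
  refine (Finset.abs_sum_le_sum_abs _ _).trans (Finset.sum_le_sum fun a _ => ?_)
  rw [abs_mul, Nat.abs_cast]
  exact mul_le_mul_of_nonneg_right (hc.abs_relParikh_le hw a) (Nat.cast_nonneg _)

end Incidence

/-! ### Recurrence and the constant `L` -/

namespace IsParryData

variable {N : ℕ} [NeZero N] {b : ℕ} {φ : Fin N → List (Fin N)} {t : ℕ → ℕ}
  {e : ℕ → List (Fin N)} {u : ℕ → Fin N}

theorem exists_iterate_singleton_eq_block (h : IsParryData b φ t e) (hu : IsFixedPoint φ u)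
    (i j : ℕ) : ∃ y, j ≤ y ∧
      (subst φ)^[i] [u j] = block u y ((subst φ)^[i] [u j]).length := by
  have h1 := hu.iterate i (j + 1)
  rw [block_add, block_one, zero_add, subst_iterate_append, List.length_append, block_add,
    zero_add] at h1
  refine ⟨((subst φ)^[i] (block u 0 j)).length, ?_, List.append_inj_right h1 (by simp)⟩
  simpa using length_le_length_subst_iterate h.ne_nil i (block u 0 j)

theorem exists_zero (h : IsParryData b φ t e) (hu : IsFixedPoint φ u) (Y : ℕ) :
    ∃ j, Y ≤ j ∧ u j = 0 := by
  obtain ⟨i, hi⟩ := h.exists_zero_mem_iterate (u Y)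
  obtain ⟨y, hy, heq⟩ := h.exists_iterate_singleton_eq_block hu i Y
  rw [heq, block, List.mem_map] at hi
  obtain ⟨k, -, hk⟩ := hi
  exact ⟨y + k, by omega, hk⟩

/-- The word `u` is recurrent: each of its prefixes occurs at arbitrarily large positions. -/
theorem exists_block_eq (h : IsParryData b φ t e) (hu : IsFixedPoint φ u) (Y m : ℕ) :
    ∃ y, Y ≤ y ∧ ∀ x n, x + n ≤ m → block u (y + x) n = block u x n := by
  -- The image `φ^m` of a late `0` is a late occurrence of the prefix of length `U_m ≥ m`.
  obtain ⟨j, hj, hj0⟩ := h.exists_zero hu Y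
  obtain ⟨y, hy, heq⟩ := h.exists_iterate_singleton_eq_block hu m j
  rw [hj0, h.iterate_zero_eq_block hu, length_block] at heq
  refine ⟨y, hj.trans hy, fun x n hxn => ?_⟩
  have h1 : m ≤ lengths φ m := (h.strictMono_lengths hu).le_apply
  have h2 := congrArg (fun w => (w.drop x).take n) heq
  simp only [drop_block] at h2
  rwa [take_block _ _ (by omega), take_block _ _ (by omega), zero_add, eq_comm] at h2

theorem exists_le_count_zero (h : IsParryData b φ t e) (hu : IsFixedPoint φ u) (k : ℕ) :
    ∃ n, k ≤ (block u 0 n).count 0 := by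
  induction k with
  | zero => exact ⟨0, Nat.zero_le _⟩
  | succ k ih =>
    obtain ⟨n, hn⟩ := ih
    obtain ⟨j, hj, hj0⟩ := h.exists_zero hu n
    obtain ⟨r, rfl⟩ := Nat.exists_eq_add_of_le hj
    refine ⟨n + r + 1, ?_⟩
    rw [block_add, block_add, block_one, zero_add, zero_add, hj0]
    simp only [List.count_append, List.count_singleton_self]
    omega

theorem exists_isWindowBound {α : Fin N → ℕ} (h : IsParryData b φ t e) (hu : IsFixedPoint φ u)
    {c : ℕ} (hc : IsBalanced c u) (H : ℕ) : ∃ L, IsWindowBound α φ u H L := by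
  -- Balance costs at most `c` zeros, so every factor of length `L` contains at least `2 α_0 + H` of
  -- them, and each adds a letter to the image.
  obtain ⟨L, hL⟩ := h.exists_le_count_zero hu (2 * α 0 + H + c)
  refine ⟨L, fun w hw hLw => ?_⟩
  obtain ⟨i, hi⟩ := hw
  obtain ⟨r, hr⟩ := Nat.exists_eq_add_of_le hLw
  have h1 := hc (block u 0 L) (block u i L) (isFactor_block u 0 L) (isFactor_block u i L)
    (by simp) 0
  have h2 := h.length_add_count_le w
  have h3 : (block u i L).count 0 ≤ w.count 0 := by
    rw [hi, hr, block_add, List.count_append]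
    omega
  have h4 := (abs_le.1 h1).2
  omega

end IsParryData

/-! ### Desubstitution of positions and the local rule for triples -/

section Positions

variable {N : ℕ} {φ : Fin N → List (Fin N)} {u : ℕ → Fin N}

/-- The position of `φ(u_x)` in `φ(u) = φ(u_0) φ(u_1) ⋯`. -/
def imagePos (φ : Fin N → List (Fin N)) (u : ℕ → Fin N) (x : ℕ) : ℕ :=
  (subst φ (block u 0 x)).length

@[simp] theorem imagePos_zero : imagePos φ u 0 = 0 := rfl

theorem imagePos_add (x n : ℕ) :
    imagePos φ u (x + n) = imagePos φ u x + (subst φ (block u x n)).length := by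
  rw [imagePos, block_add, subst_append, List.length_append, zero_add, imagePos]

theorem imagePos_succ (x : ℕ) : imagePos φ u (x + 1) = imagePos φ u x + (φ (u x)).length := by
  rw [imagePos_add, block_one, subst_singleton]

theorem subst_block (hu : IsFixedPoint φ u) (x n : ℕ) :
    subst φ (block u x n) = block u (imagePos φ u x) (subst φ (block u x n)).length := by
  have h1 := hu (x + n)
  rw [block_add, subst_append, List.length_append, block_add, zero_add, zero_add] at h1
  exact List.append_inj_right h1 (by simp)

theorem map_eq_block (hu : IsFixedPoint φ u) (x : ℕ) :
    φ (u x) = block u (imagePos φ u x) (φ (u x)).length := by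
  simpa using subst_block hu x 1

theorem parikh_block_imagePos (hu : IsFixedPoint φ u) (x : ℕ) :
    parikh (block u 0 (imagePos φ u x)) =
      Matrix.vecMul (parikh (block u 0 x)) (incidence φ) := by
  rw [← parikh_subst, hu x]
  rfl

theorem le_imagePos (hφ : ∀ a, φ a ≠ []) (x : ℕ) : x ≤ imagePos φ u x := by
  simpa [imagePos] using length_le_length_subst hφ (block u 0 x)

theorem exists_eq_imagePos_add (hφ : ∀ a, φ a ≠ []) (y : ℕ) :
    ∃ x i, i < (φ (u x)).length ∧ y = imagePos φ u x + i := by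
  induction y with
  | zero => exact ⟨0, 0, List.length_pos_iff.2 (hφ _), by simp⟩
  | succ y ih =>
    obtain ⟨x, i, hi, rfl⟩ := ih
    by_cases h : i + 1 < (φ (u x)).length
    · exact ⟨x, i + 1, h, rfl⟩
    · refine ⟨x + 1, 0, List.length_pos_iff.2 (hφ _), ?_⟩
      rw [imagePos_succ]
      omega

/-- The triple at the position `|φ(u_0 ⋯ u_{j-1})| + i` for the length `|φ(u_0 ⋯ u_{n-1})| + d`,
computed from the triple at the position `j` for the length `n`. -/
def nextTriple [NeZero N] (φ : Fin N → List (Fin N)) (L d i : ℕ)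
    (x : (Fin N → ℤ) × Fin N × List (Fin N)) :
    (Fin N → ℤ) × Fin N × List (Fin N) :=
  -- The offset of the end of the new factor inside the image of the old window. The correction at
  -- the right end is a difference of two prefixes of this image, so it covers displacements in both
  -- directions.
  let s : ℤ := (subst φ (x.2.2.take L)).length + i + d -
    ∑ b, Matrix.vecMul x.1 (incidence φ) b
  (Matrix.vecMul x.1 (incidence φ) - parikh ((φ x.2.1).take i) +
      (parikh ((subst φ x.2.2).take s.toNat) - parikh (subst φ (x.2.2.take L))) -
      Pi.single 0 (d : ℤ),
    (φ x.2.1).getD i 0,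
    ((subst φ x.2.2).drop (s - L).toNat).take (2 * L + 1))

/-- The triple at the position `j` in the set `𝒮(n)`. -/
def triple (u : ℕ → Fin N) (L n j : ℕ) : (Fin N → ℤ) × Fin N × List (Fin N) :=
  (relParikh u (block u j n), u j, block u (j + n - L) (2 * L + 1))

/-- The displacement of the right end is read off from `Ψʳᵉˡ M`, without knowing `j` or `n`. Since
`i, d ≤ α_0`, the two halves of the window, of lengths `L` and `L + 1`, have images long enough to
contain the new window. -/
theorem nextTriple_triple [NeZero N] {α : Fin N → ℕ} {H L : ℕ} (hlen : ∀ a, (φ a).length ≤ α 0 + 1)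
    (hu : IsFixedPoint φ u) (hH : IsSumBound φ u H) (hL : IsWindowBound α φ u H L) {n n' d : ℕ}
    (hd : d ≤ α 0) (hn : block u 0 n' = subst φ (block u 0 n) ++ List.replicate d 0)
    {i j : ℕ} (hj : L ≤ j) (hi : i < (φ (u j)).length) :
    triple u L n' (imagePos φ u j + i) = nextTriple φ L d i (triple u L n j) := by
  have hn' : n' = imagePos φ u n + d := by
    have := congrArg List.length hn
    simpa [imagePos] using this
  have hpn' : parikh (block u 0 n') =
      Matrix.vecMul (parikh (block u 0 n)) (incidence φ) + Pi.single 0 (d : ℤ) := by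
    rw [hn, parikh_append, parikh_subst, parikh_replicate]
  -- The window starts at `r`; because of `L ≤ j` the subtraction is not truncated.
  obtain ⟨r, hr⟩ : ∃ r, j + n = r + L := ⟨j + n - L, by omega⟩
  have hr' : j + n - L = r := by omega
  have hia := hlen (u j)
  have hsum : ∑ b, Matrix.vecMul (relParikh u (block u j n)) (incidence φ) b =
      (imagePos φ u (r + L) : ℤ) - imagePos φ u j - imagePos φ u n := by
    rw [relParikh_block, Matrix.sub_vecMul, Matrix.sub_vecMul, ← parikh_block_imagePos hu,
      ← parikh_block_imagePos hu, ← parikh_block_imagePos hu, hr]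
    simp only [Pi.sub_apply, Finset.sum_sub_distrib, sum_parikh, length_block]
  have hbound := abs_le.1 (hH _ (isFactor_block u j n))
  rw [hsum] at hbound
  have hw1 := hL _ (isFactor_block u r L) (by simp)
  have hw2 := hL _ (isFactor_block u (r + L) (L + 1)) (by simp)
  rw [length_block] at hw1 hw2
  have hp1 := imagePos_add (φ := φ) (u := u) r L
  have hp2 := imagePos_add (φ := φ) (u := u) (r + L) (L + 1)
  have hblock := subst_block hu r (2 * L + 1)
  have hlenz : (subst φ (block u r (2 * L + 1))).length =
      (subst φ (block u r L)).length + (subst φ (block u (r + L) (L + 1))).length := by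
    rw [show 2 * L + 1 = L + (L + 1) by ring, block_add, subst_append, List.length_append]
  set p := imagePos φ u j
  set q := imagePos φ u r
  -- The bounds on both halves also give `L ≤ s` and `s + L + 1 ≤ |φ(window)|`, so neither `take`
  -- nor `drop` below runs past the image.
  obtain ⟨s, hs⟩ : ∃ s, p + i + n' = q + s := ⟨p + i + n' - q, by omega⟩
  have hs' : ((subst φ (block u r L)).length : ℤ) + i + d -
      ((imagePos φ u (r + L) : ℤ) - p - imagePos φ u n) = (s : ℤ) := by
    omega
  have hsL : ((s : ℤ) - L).toNat = s - L := by omega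
  have htake : (block u r (2 * L + 1)).take L = block u r L := take_block _ _ (by omega)
  rw [triple, triple, nextTriple]
  simp only [hr', hsum, htake, hs', hsL, Int.toNat_natCast]
  refine Prod.ext ?_ (Prod.ext ?_ ?_)
  · have h1 : parikh (block u 0 (p + i)) = parikh (block u 0 p) + parikh ((φ (u j)).take i) := by
      rw [map_eq_block hu j, take_block _ _ hi.le, block_add, parikh_append, zero_add]
    have h2 : parikh (subst φ (block u r L)) =
        parikh (block u 0 (imagePos φ u (r + L))) - parikh (block u 0 q) := by
      rw [parikh_subst, parikh_block, Matrix.sub_vecMul, ← parikh_block_imagePos hu,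
        ← parikh_block_imagePos hu]
    have h3 : parikh ((subst φ (block u r (2 * L + 1))).take s) =
        parikh (block u 0 (p + i + n')) - parikh (block u 0 q) := by
      rw [hblock, take_block _ _ (by omega), parikh_block, hs]
    simp only
    rw [relParikh_block, relParikh_block, h1, h2, h3, Matrix.sub_vecMul, Matrix.sub_vecMul, hpn',
      ← parikh_block_imagePos hu j, hr, ← parikh_block_imagePos hu (r + L)]
    abel
  · have h1 := getElem?_block u p hi
    rw [← map_eq_block hu j] at h1
    simp [List.getD_eq_getElem?_getD, h1]
  · simp only
    rw [hblock, drop_block, take_block _ _ (by omega)]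
    congr 1
    omega

theorem tripleSet_eq_image (u : ℕ → Fin N) (L n : ℕ) :
    tripleSet u L n = triple u L n '' Set.Ici L := by
  ext x
  constructor
  · rintro ⟨j, hj, rfl⟩
    exact ⟨j, hj, rfl⟩
  · rintro ⟨j, hj, rfl⟩
    exact ⟨j, hj, rfl⟩

/-- All the sets are subsets of one finite set: vectors in a box of radius `c`, letters, and words
of length `2 * L + 1`. -/
theorem finite_range_tripleSet {c : ℕ} (hc : IsBalanced c u) (L : ℕ) :
    (Set.range (tripleSet u L)).Finite := by
  have h1 : {x : Fin N → ℤ | ∀ a, x a ∈ Set.Icc (-(c : ℤ)) c}.Finite := by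
    simpa [Set.pi] using Set.Finite.pi (ι := Fin N) fun _ => Set.finite_Icc (-(c : ℤ)) c
  have h2 : {w : List (Fin N) | w.length = 2 * L + 1}.Finite := List.finite_length_eq _ _
  refine ((h1.prod ((Set.finite_univ (α := Fin N)).prod h2)).finite_subsets).subset ?_
  rintro _ ⟨n, rfl⟩ _ ⟨j, -, rfl⟩
  exact ⟨fun a => abs_le.1 (hc.abs_relParikh_le (isFactor_block u j n) a), Set.mem_univ _,
    by simp⟩

end Positions

/-! ### Transitions between the sets of triples -/

namespace IsParryData

variable {N : ℕ} [NeZero N] {b : ℕ} {φ : Fin N → List (Fin N)} {t : ℕ → ℕ}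
  {e : ℕ → List (Fin N)} {u : ℕ → Fin N}

theorem exists_triple_eq (h : IsParryData b φ t e) (hu : IsFixedPoint φ u) {L j : ℕ} (n Y : ℕ)
    (hj : L ≤ j) : ∃ y, Y ≤ y ∧ triple u L n (y + j) = triple u L n j := by
  obtain ⟨y, hy, heq⟩ := h.exists_block_eq hu Y (j + n + L + 1)
  refine ⟨y, hy, ?_⟩
  have h1 := heq j 1 (by omega)
  rw [block_one, block_one] at h1
  rw [triple, triple, heq j n (by omega), List.singleton_inj.1 h1,
    show y + j + n - L = y + (j + n - L) by omega, heq _ _ (by omega)]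

theorem firstComponents_tripleSet (h : IsParryData b φ t e) (hu : IsFixedPoint φ u) (L n : ℕ) :
    firstComponents (tripleSet u L n) = relParikhSet u n := by
  ext ψ
  constructor
  · rintro ⟨_, ⟨j, -, rfl⟩, rfl⟩
    exact ⟨_, isFactor_block u j n, by simp, rfl⟩
  · rintro ⟨w, ⟨j, hj⟩, rfl, rfl⟩
    -- A factor that occurs before position `L` occurs again after it.
    obtain ⟨y, hy, heq⟩ := h.exists_block_eq hu L (j + w.length)
    exact ⟨_, ⟨y + j, by omega, rfl⟩, by rw [heq j _ le_rfl, ← hj]⟩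

theorem tripleSet_eq {α : Fin N → ℕ} (h : IsParryData (α 0) φ t e) (hu : IsFixedPoint φ u)
    {H L : ℕ} (hH : IsSumBound φ u H) (hL : IsWindowBound α φ u H L) {n n' d : ℕ}
    (hd : d ≤ α 0) (hn : block u 0 n' = subst φ (block u 0 n) ++ List.replicate d 0) :
    tripleSet u L n' =
      {y | ∃ x ∈ tripleSet u L n, ∃ i < (φ x.2.1).length, y = nextTriple φ L d i x} := by
  have key : ∀ {i j : ℕ}, L ≤ j → i < (φ (u j)).length →
      triple u L n' (imagePos φ u j + i) = nextTriple φ L d i (triple u L n j) :=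
    fun hj hi => nextTriple_triple h.length_map_le hu hH hL hd hn hj hi
  rw [tripleSet_eq_image, tripleSet_eq_image]
  ext z
  constructor
  · rintro ⟨k, hk, rfl⟩
    -- The triple is moved past the image of the first `L` letters, so that the letter whose image
    -- covers the new position has index at least `L`.
    obtain ⟨y, hy, heq⟩ := h.exists_triple_eq hu n' (imagePos φ u L) hk
    obtain ⟨j, i, hi, hji⟩ := exists_eq_imagePos_add (u := u) h.ne_nil (y + k)
    have hj : L ≤ j := by
      by_contra! hlt
      obtain ⟨r, rfl⟩ := Nat.exists_eq_add_of_lt hlt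
      rw [show j + r + 1 = (j + 1) + r by ring, imagePos_add, imagePos_succ] at hy
      omega
    exact ⟨_, ⟨j, hj, rfl⟩, i, hi, by rw [← key hj hi, ← hji, heq]⟩
  · rintro ⟨_, ⟨j, hj, rfl⟩, i, hi, rfl⟩
    have hj' : L ≤ imagePos φ u j + i :=
      (hj.trans (le_imagePos h.ne_nil j)).trans (Nat.le_add_right _ _)
    exact ⟨_, hj', key hj hi⟩

end IsParryData

theorem exists_le_forall_exists_eq {X : Type*} {f : ℕ → X} (hf : (Set.range f).Finite) (b : ℕ) :
    ∃ M, b ≤ M ∧ ∀ n, 1 ≤ n → ∃ m, 1 ≤ m ∧ m ≤ M ∧ f n = f m := by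
  -- Each value is represented by its least positive index. A value attained only at `0` yields
  -- `sInf ∅ = 0`, which does no harm.
  obtain ⟨B, hB⟩ := (hf.image fun x => sInf {m | 1 ≤ m ∧ x = f m}).bddAbove
  refine ⟨max b B, le_max_left _ _, fun n hn => ?_⟩
  obtain ⟨h1, h2⟩ := Nat.sInf_mem (s := {m | 1 ≤ m ∧ f n = f m}) ⟨n, hn, rfl⟩
  exact ⟨_, h1, (hB ⟨f n, ⟨n, rfl⟩, rfl⟩).trans (le_max_right _ _), h2⟩

theorem tripleSet_ne_empty {N : ℕ} (u : ℕ → Fin N) (L n : ℕ) : tripleSet u L n ≠ ∅ :=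
  Set.Nonempty.ne_empty ⟨_, L, le_rfl, rfl⟩

/-! ### The automaton -/

section

variable {N : ℕ} [NeZero N] {φ : Fin N → List (Fin N)} {u : ℕ → Fin N} {α : Fin N → ℕ}

theorem IsParryData.exists_isTransitionSystem {t : ℕ → ℕ} {e : ℕ → List (Fin N)}
    (h : IsParryData (α 0) φ t e) (hu : IsFixedPoint φ u) {c : ℕ} (hc : IsBalanced c u) {H L : ℕ}
    (hH : IsSumBound φ u H) (hL : IsWindowBound α φ u H L) :
    ∃ (M : ℕ) (S : Fin (M + 1) → Set ((Fin N → ℤ) × Fin N × List (Fin N)))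
      (δ : Fin (M + 1) → Fin (α 0 + 1) → Fin (M + 1)), IsTransitionSystem α φ u L M S δ := by
  obtain ⟨M, hM, hex⟩ := exists_le_forall_exists_eq (finite_range_tripleSet hc L) (α 0)
  let S : Fin (M + 1) → Set ((Fin N → ℤ) × Fin N × List (Fin N)) :=
    fun j => if j = 0 then ∅ else tripleSet u L j
  have hS : ∀ j, j ≠ 0 → S j = tripleSet u L j := fun j hj => if_neg hj
  have hS0 : S 0 = ∅ := if_pos rfl
  have hexhaust : ∀ n, 1 ≤ n → ∃ j : Fin (M + 1), j ≠ 0 ∧ tripleSet u L n = S j := by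
    intro n hn
    obtain ⟨m, hm1, hm2, heq⟩ := hex n hn
    have hm : (⟨m, by omega⟩ : Fin (M + 1)) ≠ 0 := by
      rw [Ne, Fin.ext_iff]
      simp
      omega
    exact ⟨⟨m, by omega⟩, hm, by rw [hS _ hm, heq]⟩
  -- From state `0` the first digit leads to the state of the same number, which exists because `α 0
  -- ≤ M`. From other states any index of the computed set is chosen; if there is none, the value is
  -- arbitrary.
  let δ : Fin (M + 1) → Fin (α 0 + 1) → Fin (M + 1) := fun j d =>
    if j = 0 then Fin.castLE (by omega) d else Classical.epsilon fun k =>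
      S k = {y | ∃ x ∈ S j, ∃ i < (φ x.2.1).length, y = nextTriple φ L d i x}
  refine ⟨M, S, δ, hM, hS0, ?_, hexhaust, ?_, ?_⟩
  · intro j hj _
    refine hS j ?_
    rintro rfl
    simp at hj
  · intro d _
    simp [δ]
  · intro n n' hn hn' d hrep j hj
    have hj0 : j ≠ 0 := by
      rintro rfl
      exact tripleSet_ne_empty u L n (hj.trans hS0)
    have h1 := h.tripleSet_eq hu hH hL (Nat.lt_succ_iff.1 d.isLt)
      (h.block_eq_of_normalRep_eq hu hrep)
    obtain ⟨k, -, hk⟩ := hexhaust n' hn'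
    rw [hj] at h1
    have h2 := Classical.epsilon_spec (p := fun k =>
      S k = {y | ∃ x ∈ S j, ∃ i < (φ x.2.1).length, y = nextTriple φ L d i x})
      ⟨k, hk.symm.trans h1⟩
    rw [h1, ← h2]
    simp only [δ, if_neg hj0]

/-- Induction removes the last digit. What remains is again admissible with nonzero leading digit,
hence the normal representation of the length of its expansion, and `step` applies. A one-digit word
represents the digit itself and is covered by `start` and `small`. -/
theorem IsTransitionSystem.exists_word {t : ℕ → ℕ} {e : ℕ → List (Fin N)} {L M : ℕ}
    {S : Fin (M + 1) → Set ((Fin N → ℤ) × Fin N × List (Fin N))}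
    {δ : Fin (M + 1) → Fin (α 0 + 1) → Fin (M + 1)} (hS : IsTransitionSystem α φ u L M S δ)
    (h : IsParryData (α 0) φ t e) (hu : IsFixedPoint φ u) (l : List ℕ) : ∀ n, 1 ≤ n →
      normalRep (lengths φ) n = l →
        ∃ w : List (Fin (α 0 + 1)), w.map Fin.val = l ∧ tripleSet u L n = S (w.foldl δ 0) := by
  induction l using List.reverseRecOn with
  | nil =>
    intro n hn hl
    obtain ⟨d, l, -, hdl⟩ := h.normalRep_eq_cons hu hn
    simp [hl] at hdl
  | append_singleton l d ih =>
    intro n hn hl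
    have hadm := h.admissibleDigits_normalRep hu n
    rw [hl] at hadm
    have hd : d ≤ α 0 := h.le_of_mem_admissibleDigits _ 0 hadm d (by simp)
    obtain ⟨d₀, l₀, hd₀, hdl⟩ := h.normalRep_eq_cons hu hn
    rw [hl] at hdl
    cases l with
    | nil =>
      have hd0 : d ≠ 0 := by
        simp only [List.nil_append, List.cons.injEq] at hdl
        exact hdl.1 ▸ hd₀
      have hnd : n = d := by
        rw [← h.length_expand_normalRep hu n, hl]
        simp [expand]
      refine ⟨[⟨d, by omega⟩], by simp, ?_⟩
      have h1 := hS.start ⟨d, by omega⟩ (by rw [Ne, Fin.ext_iff]; simpa using hd0)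
      simp only at h1
      rw [List.foldl_cons, List.foldl_nil, hS.small _ (by omega) (by omega), h1, hnd]
    | cons c l =>
      have hc : c = d₀ := by
        simp only [List.cons_append, List.cons.injEq] at hdl
        exact hdl.1
      have hrep := h.normalRep_length_expand hu (hc ▸ hd₀) (h.admissibleDigits_of_concat _ d 0 hadm)
      have hpos : 1 ≤ (expand φ (c :: l)).length := by
        rw [length_expand_cons]
        have := Nat.mul_pos (Nat.pos_of_ne_zero (hc ▸ hd₀)) (h.lengths_pos l.length)
        omega
      obtain ⟨w, hw, heq⟩ := ih _ hpos hrep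
      refine ⟨w ++ [⟨d, by omega⟩], by simp [hw], ?_⟩
      rw [List.foldl_append, List.foldl_cons, List.foldl_nil]
      exact hS.step _ n hpos hn ⟨d, by omega⟩ (by rw [hl, hrep]) _ heq

end

/-- A sequence is `U`-automatic if a finite transition system computes it. -/
theorem isUAutomatic_of_eval {Q : Type} [Finite Q] {X : Type v} {U : ℕ → ℕ} {b : ℕ} {x : ℕ → X}
    (D : DFAO Q (Fin (b + 1)) X)
    (h : ∀ n, 1 ≤ n → ∃ w : List (Fin (b + 1)), w.map Fin.val = normalRep U n ∧ x n = D.eval w) :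
    IsUAutomatic U b x :=
  ⟨Q, Set.range D.out, ⟨D.step, D.start, fun q => ⟨D.out q, q, rfl⟩⟩, ‹_›, Set.finite_range _, h⟩

end ParryWord

theorem mainTheorem3 {N : ℕ} [NeZero N] (α : Fin N → ℕ) (φ : Fin N → List (Fin N))
    (hφ : IsParrySubstitution α φ) (u : ℕ → Fin N) (hu : IsFixedPoint φ u)
    (c : ℕ) (hc : IsBalanced c u) :
    -- the balance function in terms of the relative Parikh vectors
    (∀ n, 1 ≤ n → IsGreatest (distances (relParikhSet u n)) (balanceFunction u n)) ∧
    -- the constants of the construction exist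
    (∃ H L, IsSumBound φ u H ∧ IsWindowBound α φ u H L) ∧
    -- one transition system computes the sets of relative Parikh vectors, hence the abelian
    -- complexity, the balance function and every other function of these sets
    (∀ H L, IsSumBound φ u H → IsWindowBound α φ u H L →
      ∃ (M : ℕ) (S : Fin (M + 1) → Set ((Fin N → ℤ) × Fin N × List (Fin N)))
        (δ : Fin (M + 1) → Fin (α 0 + 1) → Fin (M + 1)),
        IsTransitionSystem α φ u L M S δ ∧
        ∀ n, 1 ≤ n → ∃ w : List (Fin (α 0 + 1)),
          w.map Fin.val = normalRep (lengths φ) n ∧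
          relParikhSet u n = firstComponents (S (w.foldl δ 0)) ∧
          abelianComplexity u n =
            (DFAO.mk δ 0 fun j => (firstComponents (S j)).ncard).eval w ∧
          balanceFunction u n = (DFAO.mk δ 0 fun j => tauB (firstComponents (S j))).eval w ∧
          ∀ (X : Type v) (F : Set (Fin N → ℤ) → X),
            F (relParikhSet u n) = (DFAO.mk δ 0 fun j => F (firstComponents (S j))).eval w) ∧
    -- automaticity
    IsUAutomatic (lengths φ) (α 0) (balanceFunction u) ∧
    ∀ (X : Type v) (F : Set (Fin N → ℤ) → X),
      IsUAutomatic (lengths φ) (α 0) fun n => F (relParikhSet u n) := by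
  obtain ⟨t, e, h⟩ := hφ.exists_isParryData
  have hsys : ∀ H L, IsSumBound φ u H → IsWindowBound α φ u H L →
      ∃ (M : ℕ) (S : Fin (M + 1) → Set ((Fin N → ℤ) × Fin N × List (Fin N)))
        (δ : Fin (M + 1) → Fin (α 0 + 1) → Fin (M + 1)),
        IsTransitionSystem α φ u L M S δ ∧
        ∀ n, 1 ≤ n → ∃ w : List (Fin (α 0 + 1)),
          w.map Fin.val = normalRep (lengths φ) n ∧
          relParikhSet u n = firstComponents (S (w.foldl δ 0)) := by
    intro H L hH hL
    obtain ⟨M, S, δ, hS⟩ := h.exists_isTransitionSystem hu hc hH hL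
    refine ⟨M, S, δ, hS, fun n hn => ?_⟩
    obtain ⟨w, hw, heq⟩ := hS.exists_word h hu _ n hn rfl
    exact ⟨w, hw, by rw [← heq, h.firstComponents_tripleSet hu]⟩
  -- The maximum is attained, so the `sSup` in `tauB` is not a default value.
  have htau : ∀ n, balanceFunction u n = tauB (relParikhSet u n) := fun n =>
    (isGreatest_distances u n).csSup_eq.symm
  obtain ⟨H, hH⟩ := hc.exists_isSumBound φ
  obtain ⟨L, hL⟩ := h.exists_isWindowBound (α := α) hu hc H
  have hauto : ∀ (X : Type v) (F : Set (Fin N → ℤ) → X),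
      IsUAutomatic (lengths φ) (α 0) fun n => F (relParikhSet u n) := by
    intro X F
    obtain ⟨M, S, δ, -, hw⟩ := hsys H L hH hL
    refine isUAutomatic_of_eval ⟨δ, 0, fun j => F (firstComponents (S j))⟩ fun n hn => ?_
    obtain ⟨w, hw1, hw2⟩ := hw n hn
    exact ⟨w, hw1, congrArg F hw2⟩
  refine ⟨fun n _ => isGreatest_distances u n, ⟨H, L, hH, hL⟩, fun H L hH hL => ?_, ?_, hauto⟩
  · obtain ⟨M, S, δ, hS, hw⟩ := hsys H L hH hL
    refine ⟨M, S, δ, hS, fun n hn => ?_⟩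
    obtain ⟨w, hw1, hw2⟩ := hw n hn
    refine ⟨w, hw1, hw2, ?_, ?_, fun X F => congrArg F hw2⟩
    · rw [abelianComplexity_eq, hw2, DFAO.eval]
    · rw [htau, hw2, DFAO.eval]
  · obtain ⟨M, S, δ, -, hw⟩ := hsys H L hH hL
    refine isUAutomatic_of_eval ⟨δ, 0, fun j => tauB (firstComponents (S j))⟩ fun n hn => ?_
    obtain ⟨w, hw1, hw2⟩ := hw n hn
    exact ⟨w, hw1, by rw [htau, hw2, DFAO.eval]⟩
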